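/- Let $X$ be a nonempty compact complex orbifold of dimension $n$ (Hausdorff, given by charts $U/G\cong V\subset X$ with $U\subset\mathbb C^n$ open and connected and $G$ a finite group acting effectively and holomorphically on $U$), and let $L$ be an orbifold line bundle on $X$; for instance, $(X,L)$ is a polarised orbifold with cyclic stabiliser groups. Let $\mathcal K(c_1(L))$ be the set of orbifold Kähler metrics on $X$ whose Kähler form is $(2\pi)^{-1}$ times the curvature of some hermitian metric on $L$. Fix a hermitian metric $h$ on $L$ and $\omega\in\mathcal K(c_1(L))$, and put $$\mathrm{vol}=\int_X\frac{c_1(L)^n}{n!}=\int_X\frac{\omega^n}{n!}.$$ Fix an integer $k\ge 0$, a finite set $I$ of non-negative integers with $k+i>0$ for all $i\in I$, and positive real numbers $c_i$ $(i\in I)$, and put $$V=\bigoplus_{i\in I}H^0(L^{k+i})^*,\qquad c=\sum_{i\in I}c_i\,(k+i)\,h^0(L^{k+i}).$$ Assume that the map $\phi_k\colon x\mapsto[\oplus_i \mathrm{ev}_x^{k+i}]$ from $X$ to the weighted projective space $\mathbb P(V)$ (with $H^0(L^{k+i})^*$ in weight $k+i$) is everywhere defined, i.e. for each $x\in X$ some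 $L^{k+i}$, $i\in I$, has a global section that does not vanish at $x$. (For a polarised orbifold with cyclic stabilisers and $I=\{0,\dots,M\}$, $M\ge\mathrm{ord}(X)$, this holds for all $k\gg0$.) Let $\mathrm{Hilb}(h,\omega)$ be the graded hermitian metric given on $H^0(L^{k+i})$ by $$|s|^2_{\mathrm{Hilb}(h,\omega)}=\frac1{c_i\,\mathrm{vol}}\int_X|s|_h^2\,\frac{\omega^n}{n!},$$ and on $V$ by duality. For a nonzero lift $\tilde x\in L_x^{-1}$ of $x\in X$, let $\mathrm{ev}^{k+i}_{\tilde x}\in H^0(L^{k+i})^*$ be the evaluation $s\mapsto\langle \tilde x^{\otimes(k+i)},s(x)\rangle$, and let $\lambda(\tilde x)$ be the unique positive real number with $$\sum_{i\in I}(k+i)\,\lambda(\tilde x)^{2(k+i)}\,\bigl|\mathrm{ev}^{k+i}_{\tilde x}\bigr|^2_{\mathrm{Hilb}(h,\omega)}=c .$$ Let $h_{FS}$ be the fibre metric on $L$ in $FS\circ\mathrm{Hilb}(h,\omega)$, i.e. the metric whose dual on $L^{-1}=\phi_k^*\mathcal O_{\mathbb P(V)}(-1)$ is $|\tilde x|_{h_{FS}}=1/\lambda(\tilde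 x)$. Let $$B_k(h,\omega)=\sum_{i\in I}(k+i)\sum_\alpha|t^i_\alpha|_h^2$$ be the weighted Bergman kernel, where $\{t^i_\alpha\}$ is any graded basis of $\bigoplus_{i\in I}H^0(L^{k+i})$ that is orthonormal with respect to $\mathrm{Hilb}(h,\omega)$. Then $h=h_{FS}$ if and only if $B_k(h,\omega)$ is constant on $X$. Moreover, if $B_k(h,\omega)$ is constant on $X$, then this constant is $c$. -/

import Mathlib

open scoped ContDiff ComplexConjugate ComplexOrder
open MeasureTheory

noncomputable section

universe u v

/-- A complex orbifold structure of dimension `n` on the space `X`, given by an atlas.  The chart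
`a` is a connected open set `U a` in `ℂⁿ`, a finite group `G a` of holomorphic bijections of `U a`
(so the action is effective), and a continuous open map `π a : U a → X` whose fibres are the
`G a`-orbits; that is, `π a` induces a homeomorphism of `U a / G a` onto an open set of `X`.
Any two lifts of a point of `X` are related by a local biholomorphism over `X`. -/
structure OrbifoldAtlas (n : ℕ) (X : Type u) [TopologicalSpace X] where
  Idx : Type v
  U : Idx → Set (Fin n → ℂ)
  isOpen_U : ∀ a, IsOpen (U a)
  isConnected_U : ∀ a, IsConnected (U a)
  G : ∀ a, Subgroup (Equiv.Perm (U a))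
  finite_G : ∀ a, Finite (G a)
  holomorphic_G : ∀ a, ∀ g ∈ G a, ∃ f : (Fin n → ℂ) → (Fin n → ℂ),
    DifferentiableOn ℂ f (U a) ∧ ∀ z : U a, f z = (g z : Fin n → ℂ)
  π : ∀ a, U a → X
  continuous_π : ∀ a, Continuous (π a)
  isOpenMap_π : ∀ a, IsOpenMap (π a)
  π_eq_iff : ∀ a (z w : U a), π a z = π a w ↔ ∃ g ∈ G a, g z = w
  cover : ∀ x : X, ∃ (a : Idx) (z : U a), π a z = x
  compatible : ∀ (a b : Idx) (z : U a) (w : U b), π a z = π b w →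
    ∃ e : OpenPartialHomeomorph (Fin n → ℂ) (Fin n → ℂ),
      (e.source ⊆ U a ∧ DifferentiableOn ℂ e e.source ∧ DifferentiableOn ℂ e.symm e.target ∧
        ∀ p ∈ e.source, ∃ (hp : p ∈ U a) (hq : e p ∈ U b), π b ⟨e p, hq⟩ = π a ⟨p, hp⟩) ∧
      (z : Fin n → ℂ) ∈ e.source ∧ e z = w

namespace OrbifoldAtlas

variable {n : ℕ} {X : Type u} [TopologicalSpace X]

/-- A change of charts from the chart `a` to the chart `b`: a biholomorphism from an open subset
of `U a` onto an open subset of `U b`, commuting with the projections to `X`.  For `a = b` these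
are, locally, the elements of `G a`. -/
structure Transition (O : OrbifoldAtlas.{u, v} n X) (a b : O.Idx) where
  e : OpenPartialHomeomorph (Fin n → ℂ) (Fin n → ℂ)
  source_subset : e.source ⊆ O.U a
  holomorphic : DifferentiableOn ℂ e e.source
  holomorphic_symm : DifferentiableOn ℂ e.symm e.target
  commutes : ∀ p ∈ e.source, ∃ (hp : p ∈ O.U a) (hq : e p ∈ O.U b),
    O.π b ⟨e p, hq⟩ = O.π a ⟨p, hp⟩

/-- Some chart around the point `x`. -/
def chartAt (O : OrbifoldAtlas.{u, v} n X) (x : X) : O.Idx := (O.cover x).choose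

/-- Some lift of the point `x` to the chart `O.chartAt x`. -/
def liftAt (O : OrbifoldAtlas.{u, v} n X) (x : X) : O.U (O.chartAt x) :=
  (O.cover x).choose_spec.choose

/-- The Wirtinger derivative `∂f/∂z_j = (∂f/∂x_j - i ∂f/∂y_j) / 2`. -/
def dWirt (j : Fin n) (f : (Fin n → ℂ) → ℂ) (z : Fin n → ℂ) : ℂ :=
  (fderiv ℝ f z (Pi.single j 1) - Complex.I * fderiv ℝ f z (Pi.single j Complex.I)) / 2

/-- The Wirtinger derivative `∂f/∂z̄_j = (∂f/∂x_j + i ∂f/∂y_j) / 2`. -/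
def dbarWirt (j : Fin n) (f : (Fin n → ℂ) → ℂ) (z : Fin n → ℂ) : ℂ :=
  (fderiv ℝ f z (Pi.single j 1) + Complex.I * fderiv ℝ f z (Pi.single j Complex.I)) / 2

/-- The complex Jacobian matrix `∂f_p/∂z_q` of a holomorphic map. -/
def jacobian (f : (Fin n → ℂ) → (Fin n → ℂ)) (z : Fin n → ℂ) : Matrix (Fin n) (Fin n) ℂ :=
  Matrix.of fun p q => fderiv ℂ f z (Pi.single q 1) p

/-- An orbifold Kähler metric, by its Kähler form `Ω = i ∑ W_{jk} dz_j ∧ dz̄_k` in the charts, with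
`W` smooth and positive definite, `dΩ = 0`, and `Ω` invariant under all changes of charts (in
particular under the groups `G a`).  Only the values of `W a` on `U a` matter. -/
structure KahlerMetric (O : OrbifoldAtlas.{u, v} n X) where
  W : ∀ _ : O.Idx, (Fin n → ℂ) → Matrix (Fin n) (Fin n) ℂ
  smooth : ∀ a j k, ContDiffOn ℝ ∞ (fun z => W a z j k) (O.U a)
  posDef : ∀ a, ∀ z ∈ O.U a, (W a z).PosDef
  closed : ∀ a, ∀ z ∈ O.U a, ∀ j k l,
    dWirt l (fun p => W a p j k) z = dWirt j (fun p => W a p l k) z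
  invariant : ∀ (a b : O.Idx) (e : O.Transition a b), ∀ z ∈ e.e.source,
    W a z = (jacobian e.e z).transpose * W b (e.e z) * (jacobian e.e z).map conj

namespace KahlerMetric

variable {O : OrbifoldAtlas.{u, v} n X} [MeasurableSpace X]

/-- The contribution of one chart to the volume measure: as `i dz ∧ dz̄ = 2 dx ∧ dy`, the form
`Ωⁿ/n!` is `2ⁿ det W` times Lebesgue measure on `U a`; it is pushed forward to `X` and divided by
the order of `G a`. -/
def chartMeasure (Ω : O.KahlerMetric) (a : O.Idx) : Measure X :=
  ((Nat.card (O.G a) : ENNReal)⁻¹) •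
    Measure.map (O.π a)
      ((Measure.comap (Subtype.val : O.U a → Fin n → ℂ) volume).withDensity
        fun z => ENNReal.ofReal ((2 : ℝ) ^ n * (Ω.W a z).det.re))

/-- The measure `Ωⁿ/n!` on `X`.  The measures `chartMeasure Ω a`, which live on the open sets
`O.π a (O.U a)`, agree on overlaps; their supremum is the measure obtained by gluing them. -/
def measure (Ω : O.KahlerMetric) : Measure X := ⨆ a, Ω.chartMeasure a

/-- `∫_X Ωⁿ/n!`; this is `∫_X c₁(L)ⁿ/n!` when `Ω` represents `c₁(L)`. -/
def vol (Ω : O.KahlerMetric) : ℝ := (Ω.measure Set.univ).toReal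

end KahlerMetric

end OrbifoldAtlas

/-- An orbifold line bundle, trivialised on the charts (every orbifold line bundle is trivial on
the members of a fine enough atlas).  A change of charts `e` from `a` to `b` identifies the point
`(z, ξ)` of `U a × ℂ` with `(e z, g e z * ξ)`.  The cocycle condition also says that `g e z` depends
only on the germ of `e` at `z`, and for `a = b` it gives the action of `G a` on the bundle. -/
structure OrbifoldLineBundle {n : ℕ} {X : Type u} [TopologicalSpace X]
    (O : OrbifoldAtlas.{u, v} n X) where
  g : ∀ {a b : O.Idx}, O.Transition a b → (Fin n → ℂ) → ℂ
  holomorphic : ∀ {a b : O.Idx} (e : O.Transition a b), DifferentiableOn ℂ (g e) e.e.source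
  ne_zero : ∀ {a b : O.Idx} (e : O.Transition a b), ∀ z ∈ e.e.source, g e z ≠ 0
  cocycle : ∀ {a b c : O.Idx} (e : O.Transition a b) (f : O.Transition b c) (d : O.Transition a c)
    (z : Fin n → ℂ), z ∈ e.e.source → e.e z ∈ f.e.source → z ∈ d.e.source →
    (∀ᶠ p in nhds z, d.e p = f.e (e.e p)) → g d z = g f (e.e z) * g e z

namespace OrbifoldLineBundle

open OrbifoldAtlas

variable {n : ℕ} {X : Type u} [TopologicalSpace X] {O : OrbifoldAtlas.{u, v} n X}

/-- A (smooth) hermitian metric on `L`: `w a z` is the squared norm of the frame `1` of `U a × ℂ`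
at `z`, so that `|ξ|² = w a z * ‖ξ‖²`.  Only the values of `w a` on `U a` matter. -/
structure HermitianMetric (L : OrbifoldLineBundle O) where
  w : O.Idx → (Fin n → ℂ) → ℝ
  smooth : ∀ a, ContDiffOn ℝ ∞ (w a) (O.U a)
  pos : ∀ a, ∀ z ∈ O.U a, 0 < w a z
  invariant : ∀ (a b : O.Idx) (e : O.Transition a b), ∀ z ∈ e.e.source,
    w a z = w b (e.e z) * ‖L.g e z‖ ^ 2

/-- `(2π)⁻¹` times the curvature form of a hermitian metric, `-(i/2π) ∂∂̄ log w`, in the form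
`i ∑ W_{jk} dz_j ∧ dz̄_k`. -/
def HermitianMetric.chernMatrix {L : OrbifoldLineBundle O} (h : L.HermitianMetric)
    (a : O.Idx) (z : Fin n → ℂ) : Matrix (Fin n) (Fin n) ℂ :=
  Matrix.of fun j k =>
    -(1 / (2 * Real.pi : ℂ)) * dWirt j (dbarWirt k fun p => ((Real.log (h.w a p) : ℝ) : ℂ)) z

/-- The set `𝒦(c₁(L))` of the orbifold Kähler metrics that are `(2π)⁻¹` times the curvature of some
hermitian metric on `L`. -/
def kahlerClass (L : OrbifoldLineBundle O) : Set O.KahlerMetric :=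
  {Ω | ∃ h : L.HermitianMetric, ∀ a, ∀ z ∈ O.U a, Ω.W a z = h.chernMatrix a z}

/-- The space `H⁰(L^r)` of holomorphic sections: a section is given by holomorphic functions on the
charts which match under all changes of charts.  These functions are put equal to `0` outside
the charts, so that a section is determined by its values. -/
def H0 (L : OrbifoldLineBundle O) (r : ℕ) : Submodule ℂ (O.Idx → (Fin n → ℂ) → ℂ) where
  carrier := {s | (∀ a, DifferentiableOn ℂ (s a) (O.U a)) ∧ (∀ a, ∀ z ∉ O.U a, s a z = 0) ∧
    ∀ (a b : O.Idx) (e : O.Transition a b), ∀ z ∈ e.e.source,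
      s b (e.e z) = L.g e z ^ r * s a z}
  zero_mem' := by
    refine ⟨fun a => ?_, fun a z _ => rfl, fun a b e z _ => by simp⟩
    exact differentiableOn_const (0 : ℂ)
  add_mem' := by
    rintro s t ⟨hs, hs', hs''⟩ ⟨ht, ht', ht''⟩
    refine ⟨fun a => (hs a).add (ht a), fun a z hz => ?_, fun a b e z hz => ?_⟩
    · simp [hs' a z hz, ht' a z hz]
    · simp [hs'' a b e z hz, ht'' a b e z hz, mul_add]
  smul_mem' := by
    rintro c s ⟨hs, hs', hs''⟩
    refine ⟨fun a => (hs a).const_smul c, fun a z hz => ?_, fun a b e z hz => ?_⟩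
    · simp [hs' a z hz]
    · simp only [Pi.smul_apply, smul_eq_mul, hs'' a b e z hz]
      ring

/-- `h⁰(L^r)`. -/
def h0 (L : OrbifoldLineBundle O) (r : ℕ) : ℕ := Module.finrank ℂ (L.H0 r)

/-- The pointwise hermitian product `(s, t)_h` of two sections of `L^r`, a function on `X`. -/
def pairing {L : OrbifoldLineBundle O} (h : L.HermitianMetric) {r : ℕ} (s t : L.H0 r) (x : X) : ℂ :=
  s.1 (O.chartAt x) (O.liftAt x) * conj (t.1 (O.chartAt x) (O.liftAt x)) *
    ((h.w (O.chartAt x) (O.liftAt x) : ℝ) : ℂ) ^ r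

/-- The pointwise squared norm `|s|²_h` of a section of `L^r`, a function on `X`. -/
def normSq {L : OrbifoldLineBundle O} (h : L.HermitianMetric) {r : ℕ} (s : L.H0 r) (x : X) : ℝ :=
  ‖s.1 (O.chartAt x) (O.liftAt x)‖ ^ 2 * h.w (O.chartAt x) (O.liftAt x) ^ r

/-- Evaluation of the sections of `L^r` at the point `z` of the chart `a`, in the trivialisation of
`L` on this chart. -/
def ev (L : OrbifoldLineBundle O) (r : ℕ) (a : O.Idx) (z : Fin n → ℂ) :
    Module.Dual ℂ (L.H0 r) where
  toFun s := s.1 a z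
  map_add' _ _ := rfl
  map_smul' _ _ := rfl

/-- The map `φ_k`, which sends a point to the class of its evaluations in the weighted projective
space of `V = ⨁_{i ∈ I} H⁰(L^{k+i})*`, is defined at all points of `X`: at no point do all the
evaluations vanish. -/
def EmbeddingDefined (L : OrbifoldLineBundle O) (k : ℕ) (I : Finset ℕ) : Prop :=
  ∀ a, ∀ z ∈ O.U a, ∃ i ∈ I, L.ev (k + i) a z ≠ 0

/-- The constant `∑_{i ∈ I} c_i (k + i) h⁰(L^{k+i})`. -/
def balancingConstant (L : OrbifoldLineBundle O) (k : ℕ) (I : Finset ℕ) (c : ℕ → ℝ) : ℝ :=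
  ∑ i ∈ I, c i * (k + i : ℕ) * L.h0 (k + i)

/-- For a metric on `V` with norms `N i` on the summands `V_{k+i} = H⁰(L^{k+i})*`, and `v` in `V`:
the unique positive number `l` with `∑_i (k+i) l^{2(k+i)} |v_{k+i}|² = C`, where `C` is
the constant `∑_i c_i (k+i) dim V_{k+i}`. -/
def fsLambda (L : OrbifoldLineBundle O) (k : ℕ) (I : Finset ℕ) (c : ℕ → ℝ)
    (N : ∀ i, Module.Dual ℂ (L.H0 (k + i)) → ℝ) (v : ∀ i, Module.Dual ℂ (L.H0 (k + i))) : ℝ :=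
  Classical.epsilon fun l : ℝ => 0 < l ∧
    ∑ i ∈ I, ((k + i : ℕ) : ℝ) * l ^ (2 * (k + i)) * N i (v i) ^ 2 = L.balancingConstant k I c

/-- The Fubini-Study norm `1 / λ(v)` of a nonzero vector `v` of `V`, considered as a point of the
fibre of `𝒪(-1)` over the class of `v`. -/
def fsNorm (L : OrbifoldLineBundle O) (k : ℕ) (I : Finset ℕ) (c : ℕ → ℝ)
    (N : ∀ i, Module.Dual ℂ (L.H0 (k + i)) → ℝ) (v : ∀ i, Module.Dual ℂ (L.H0 (k + i))) : ℝ :=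
  1 / L.fsLambda k I c N v

/-- The hermitian metric `φ_k^* h_FS` on `L = φ_k^* 𝒪(1)`, by the squared norms of the frames of `L`
on the charts.  The dual frame of `L⁻¹ = φ_k^* 𝒪(-1)` at `z` is the vector of evaluations at `z`,
and dual frames have inverse norms. -/
def fsMetric (L : OrbifoldLineBundle O) (k : ℕ) (I : Finset ℕ) (c : ℕ → ℝ)
    (N : ∀ i, Module.Dual ℂ (L.H0 (k + i)) → ℝ) (a : O.Idx) (z : Fin n → ℂ) : ℝ :=
  ((L.fsNorm k I c N fun i => L.ev (k + i) a z)⁻¹) ^ 2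

section Hilb

variable [MeasurableSpace X] {L : OrbifoldLineBundle O}

/-- The hermitian inner product `Hilb(h, Ω)` on `H⁰(L^{k+i})`,
`(s, t) ↦ (c_i vol)⁻¹ ∫_X (s, t)_h Ωⁿ/n!`. -/
def hilbInner (h : L.HermitianMetric) (Ω : O.KahlerMetric) (k : ℕ) (c : ℕ → ℝ) (i : ℕ)
    (s t : L.H0 (k + i)) : ℂ :=
  ((1 / (c i * Ω.vol) : ℝ) : ℂ) * ∫ x, pairing h s t x ∂Ω.measure

/-- The metric `Hilb(h, Ω)` on the summand `V_{k+i} = H⁰(L^{k+i})*` of `V`: the norm dual to the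
norm of the inner product `hilbInner` on `H⁰(L^{k+i})`. -/
def hilbNorm (h : L.HermitianMetric) (Ω : O.KahlerMetric) (k : ℕ) (c : ℕ → ℝ) (i : ℕ)
    (v : Module.Dual ℂ (L.H0 (k + i))) : ℝ :=
  sSup {r : ℝ | ∃ s : L.H0 (k + i), (hilbInner h Ω k c i s s).re ≤ 1 ∧ r = ‖v s‖}

/-- A graded basis of `⨁_{i ∈ I} H⁰(L^{k+i})` that is orthonormal for `Hilb(h, Ω)`. -/
structure HilbBasis (h : L.HermitianMetric) (Ω : O.KahlerMetric) (k : ℕ) (I : Finset ℕ)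
    (c : ℕ → ℝ) where
  t : ∀ i : I, Module.Basis (Fin (L.h0 (k + i))) ℂ (L.H0 (k + i))
  orthonormal : ∀ (i : I) (α β : Fin (L.h0 (k + i))),
    hilbInner h Ω k c i (t i α) (t i β) = if α = β then 1 else 0

/-- The weighted Bergman kernel `B_k(h, Ω) = ∑_i (k+i) ∑_α |t^i_α|²_h`, computed with
a `Hilb(h, Ω)`-orthonormal graded basis (on the choice of which it does not depend). -/
def HilbBasis.bergmanKernel {h : L.HermitianMetric} {Ω : O.KahlerMetric} {k : ℕ} {I : Finset ℕ}
    {c : ℕ → ℝ} (T : HilbBasis h Ω k I c) (x : X) : ℝ :=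
  ∑ i : I, ((k + i : ℕ) : ℝ) * ∑ α, normSq h (T.t i α) x

end Hilb

end OrbifoldLineBundle

end

/-! Fix a point `z` of a chart and put `w = h.w a z`. In an orthonormal basis the squared dual norm
of the evaluation at `z` is the sum of the squared basis values (`hilbNorm_sq`), so the Bergman
kernel there is `∑ (k+i) w^(k+i) |ev|²` (`bergmanKernel_π`). This is the left side of the equation
defining `λ`, taken at `λ² = w`. That left side increases strictly in `λ > 0`, so `h` agrees with
the Fubini-Study metric at `z` exactly when the kernel there equals the balancing constant
(`eq_fsMetric_iff`).

It remains to see that a constant kernel can only take this value. Each orthonormal section has `∫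
|t|²_h = c_i vol`, so the kernel has integral `balancingConstant * vol` (`integral_bergmanKernel`),
and `vol ≠ 0` can be cancelled. -/

open OrbifoldAtlas OrbifoldLineBundle

/-! ### Passing between `X` and its charts -/

namespace OrbifoldAtlas

variable {n : ℕ} {X : Type u} [TopologicalSpace X]

theorem π_liftAt (O : OrbifoldAtlas.{u, v} n X) (x : X) :
    O.π (O.chartAt x) (O.liftAt x) = x :=
  (O.cover x).choose_spec.choose_spec

/-- Two lifts of the same point are related by a change of charts. -/
theorem exists_transition (O : OrbifoldAtlas.{u, v} n X) {a b : O.Idx} {z : O.U a} {w : O.U b}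
    (hzw : O.π a z = O.π b w) :
    ∃ e : O.Transition a b, (z : Fin n → ℂ) ∈ e.e.source ∧ e.e z = w := by
  obtain ⟨e, ⟨h1, h2, h3, h4⟩, h5, h6⟩ := O.compatible a b z w hzw
  exact ⟨⟨e, h1, h2, h3, h4⟩, h5, h6⟩

/-- A function on `X` is continuous if its pull-backs to the charts are. -/
theorem continuous_of_charts (O : OrbifoldAtlas.{u, v} n X) {Y : Type*} [TopologicalSpace Y]
    {f : X → Y} (hf : ∀ a, Continuous fun z : O.U a => f (O.π a z)) : Continuous f := by
  refine continuous_iff_continuousAt.2 fun x => ?_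
  obtain ⟨a, z, rfl⟩ := O.cover x
  -- As `π a` is open and continuous, neighbourhoods of `π a z` are the images of neighbourhoods of
  -- `z`, so limits can be tested upstairs.
  have hmap := (O.isOpenMap_π a).map_nhds_eq (O.continuous_π a).continuousAt (x := z)
  rw [ContinuousAt, ← hmap, Filter.tendsto_map'_iff]
  exact (hf a).continuousAt

end OrbifoldAtlas

/-! ### Pointwise hermitian products of sections -/

namespace OrbifoldLineBundle

variable {n : ℕ} {X : Type u} [TopologicalSpace X] {O : OrbifoldAtlas.{u, v} n X}
  {L : OrbifoldLineBundle O}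

/-- The hermitian product of two sections can be computed in any chart. -/
theorem pairing_π (h : L.HermitianMetric) {r : ℕ} (s t : L.H0 r) (a : O.Idx) (z : O.U a) :
    pairing h s t (O.π a z) = s.1 a z * conj (t.1 a z) * ((h.w a z : ℝ) : ℂ) ^ r := by
  obtain ⟨e, hz, hez⟩ := O.exists_transition (O.π_liftAt (O.π a z)).symm
  have hs := s.2.2.2 _ _ e z hz
  have ht := t.2.2.2 _ _ e z hz
  have hw := h.invariant _ _ e z hz
  rw [hez] at hs ht hw
  rw [pairing, hs, ht, hw]
  -- The factors `g^r` and `conj g^r` from the two sections make up exactly the factor `‖g‖^(2r)` by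
  -- which the `r`-th powers of the weights differ.
  have hg : ((‖L.g e z‖ : ℂ)) ^ 2 = L.g e z * conj (L.g e z) := (Complex.mul_conj' _).symm
  push_cast
  rw [hg, map_mul, map_pow, mul_pow, mul_pow]
  ring

theorem ofReal_normSq (h : L.HermitianMetric) {r : ℕ} (s : L.H0 r) (x : X) :
    ((normSq h s x : ℝ) : ℂ) = pairing h s s x := by
  simp [normSq, pairing, Complex.mul_conj']

/-- The squared norm of a section can be computed in any chart. -/
theorem normSq_π (h : L.HermitianMetric) {r : ℕ} (s : L.H0 r) (a : O.Idx) (z : O.U a) :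
    normSq h s (O.π a z) = ‖s.1 a z‖ ^ 2 * h.w a z ^ r := by
  have := ofReal_normSq h s (O.π a z)
  rw [pairing_π, Complex.mul_conj'] at this
  exact_mod_cast this

theorem continuous_pairing (h : L.HermitianMetric) {r : ℕ} (s t : L.H0 r) :
    Continuous (pairing h s t) := by
  refine O.continuous_of_charts fun a => ?_
  simp only [pairing_π]
  have hs := continuousOn_iff_continuous_domRestrict.1 (s.2.1 a).continuousOn
  have ht := continuousOn_iff_continuous_domRestrict.1 (t.2.1 a).continuousOn
  have hw := continuousOn_iff_continuous_domRestrict.1 (h.smooth a).continuousOn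
  exact (hs.mul (Complex.continuous_conj.comp ht)).mul ((Complex.continuous_ofReal.comp hw).pow r)

theorem pairing_sum_smul (h : L.HermitianMetric) {r : ℕ} {ι : Type*} (A : Finset ι) (p q : ι → ℂ)
    (s t : ι → L.H0 r) (x : X) :
    pairing h (∑ i ∈ A, p i • s i) (∑ i ∈ A, q i • t i) x =
      ∑ i ∈ A, ∑ j ∈ A, p i * conj (q j) * pairing h (s i) (t j) x := by
  have key : ∀ (p : ι → ℂ) (s : ι → L.H0 r) a z,
      (∑ i ∈ A, p i • s i : L.H0 r).1 a z = ∑ i ∈ A, p i * (s i).1 a z := fun p s a z => by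
    have := map_sum (L.ev r a z) (fun i => p i • s i) A
    simp only [map_smul, smul_eq_mul] at this
    exact this
  simp only [pairing, key, map_sum, map_mul]
  rw [Finset.sum_mul_sum, Finset.sum_mul]
  refine Finset.sum_congr rfl fun i _ => ?_
  rw [Finset.sum_mul]
  exact Finset.sum_congr rfl fun j _ => by ring

/-! ### The inner product `Hilb(h, Ω)` and its dual norm -/

section Hilb

variable [MeasurableSpace X] {h : L.HermitianMetric} {Ω : O.KahlerMetric} {k : ℕ}
  {c : ℕ → ℝ}

theorem integrable_pairing [CompactSpace X] [BorelSpace X] [IsFiniteMeasure Ω.measure] {r : ℕ}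
    (s t : L.H0 r) : Integrable (pairing h s t) Ω.measure :=
  (continuous_pairing h s t).integrable_of_hasCompactSupport
    (HasCompactSupport.of_compactSpace _)

theorem hilbInner_sum_smul [CompactSpace X] [BorelSpace X] [IsFiniteMeasure Ω.measure] {i : ℕ}
    {ι : Type*} (A : Finset ι) (p q : ι → ℂ) (s t : ι → L.H0 (k + i)) :
    hilbInner h Ω k c i (∑ α ∈ A, p α • s α) (∑ α ∈ A, q α • t α) =
      ∑ α ∈ A, ∑ β ∈ A, p α * conj (q β) * hilbInner h Ω k c i (s α) (t β) := by
  have hint : ∀ α β, Integrable (fun x => p α * conj (q β) * pairing h (s α) (t β) x)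
      Ω.measure := fun α β => (integrable_pairing _ _).const_mul _
  simp only [hilbInner, pairing_sum_smul]
  rw [integral_finsetSum _ fun α _ => integrable_finsetSum _ fun β _ => hint α β,
    Finset.mul_sum]
  refine Finset.sum_congr rfl fun α _ => ?_
  rw [integral_finsetSum _ fun β _ => hint α β, Finset.mul_sum]
  refine Finset.sum_congr rfl fun β _ => ?_
  rw [integral_const_mul]
  ring

/-- In an orthonormal basis, the square of the dual norm is the sum of the squares of the values
on the basis. -/
theorem hilbNorm_sq [CompactSpace X] [BorelSpace X] [IsFiniteMeasure Ω.measure] {i : ℕ}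
    {ι : Type*} [Fintype ι] [DecidableEq ι] (t : Module.Basis ι ℂ (L.H0 (k + i)))
    (ht : ∀ α β, hilbInner h Ω k c i (t α) (t β) = if α = β then 1 else 0)
    (v : Module.Dual ℂ (L.H0 (k + i))) :
    hilbNorm h Ω k c i v ^ 2 = ∑ α, ‖v (t α)‖ ^ 2 := by
  set S : ℝ := ∑ α, ‖v (t α)‖ ^ 2 with hS
  have hS0 : 0 ≤ S := Finset.sum_nonneg fun _ _ => sq_nonneg _
  have hin : ∀ p : ι → ℂ, (hilbInner h Ω k c i (∑ α, p α • t α) (∑ α, p α • t α)).re =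
      ∑ α, ‖p α‖ ^ 2 := fun p => by
    rw [hilbInner_sum_smul]
    simp only [ht, mul_ite, mul_one, mul_zero, Finset.sum_ite_eq, Finset.mem_univ, if_true,
      Complex.mul_conj']
    norm_cast
  have hv : ∀ p : ι → ℂ, v (∑ α, p α • t α) = ∑ α, p α * v (t α) := fun p => by
    simp [map_sum]
  have hgreat : IsGreatest {r : ℝ | ∃ s : L.H0 (k + i), (hilbInner h Ω k c i s s).re ≤ 1 ∧
      r = ‖v s‖} (Real.sqrt S) := by
    constructor
    -- The normalised Riesz representative of `v` attains the supremum. If `S = 0`, division by zero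
    -- turns it into the zero section, which still works.
    · refine ⟨∑ α, (conj (v (t α)) / (Real.sqrt S : ℂ)) • t α, ?_, ?_⟩
      · rw [hin]
        simp only [norm_div, RCLike.norm_conj, div_pow, Complex.norm_real, Real.norm_eq_abs, sq_abs,
          Real.sq_sqrt hS0, ← Finset.sum_div]
        exact div_self_le_one S
      · rw [hv]
        have : ∑ α, conj (v (t α)) / (Real.sqrt S : ℂ) * v (t α) = ((Real.sqrt S : ℝ) : ℂ) := by
          have h1 : ∀ α, conj (v (t α)) / (Real.sqrt S : ℂ) * v (t α) =
              ((‖v (t α)‖ ^ 2 / Real.sqrt S : ℝ) : ℂ) := fun α => by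
            rw [div_mul_eq_mul_div, Complex.conj_mul']
            push_cast
            rfl
          simp only [h1]
          rw [← Complex.ofReal_sum, ← Finset.sum_div, ← hS, Real.div_sqrt]
        rw [this, Complex.norm_real, Real.norm_of_nonneg (Real.sqrt_nonneg S)]
    -- The upper bound is Cauchy-Schwarz in the coordinates of the basis.
    · rintro _ ⟨s, hs, rfl⟩
      rw [← t.sum_repr s] at hs ⊢
      rw [hin] at hs
      rw [hv]
      refine Real.le_sqrt_of_sq_le ?_
      calc ‖∑ α, t.repr s α * v (t α)‖ ^ 2
          ≤ (∑ α, ‖t.repr s α‖ * ‖v (t α)‖) ^ 2 := by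
            gcongr
            refine (norm_sum_le _ _).trans_eq ?_
            simp only [norm_mul]
        _ ≤ (∑ α, ‖t.repr s α‖ ^ 2) * S := Finset.sum_mul_sq_le_sq_mul_sq _ _ _
        _ ≤ S := mul_le_of_le_one_left hS0 hs
  rw [hilbNorm, hgreat.csSup_eq, Real.sq_sqrt hS0]

/-! ### The Bergman kernel in charts and its integral -/

namespace HilbBasis

variable {I : Finset ℕ}

/-- The weighted Bergman kernel in a chart, through the dual norms of the evaluations. -/
theorem bergmanKernel_π [CompactSpace X] [BorelSpace X] [IsFiniteMeasure Ω.measure]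
    (T : HilbBasis h Ω k I c) (a : O.Idx) (z : O.U a) :
    T.bergmanKernel (O.π a z) = ∑ i ∈ I, ((k + i : ℕ) : ℝ) * h.w a z ^ (k + i) *
      hilbNorm h Ω k c i (L.ev (k + i) a z) ^ 2 := by
  rw [← Finset.sum_coe_sort I, bergmanKernel]
  refine Finset.sum_congr rfl fun i _ => ?_
  rw [hilbNorm_sq (T.t i) (T.orthonormal i), mul_assoc, Finset.mul_sum (a := h.w a z ^ (k + i.1))]
  congr 1
  refine Finset.sum_congr rfl fun α _ => ?_
  rw [normSq_π, mul_comm]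
  rfl

theorem integral_normSq (T : HilbBasis h Ω k I c) (i : I) (α : Fin (L.h0 (k + i))) :
    ∫ x, normSq h (T.t i α) x ∂Ω.measure = c i * Ω.vol := by
  have h1 := T.orthonormal i α α
  simp only [hilbInner, if_true, ← ofReal_normSq] at h1
  rw [integral_complex_ofReal, ← Complex.ofReal_mul, Complex.ofReal_eq_one] at h1
  -- A zero here would make the normalising factor `1 / 0 = 0`, and no section could have norm one.
  have h2 : c i * Ω.vol ≠ 0 := fun h0 => by simp [h0] at h1
  rwa [one_div, inv_mul_eq_one₀ h2, eq_comm] at h1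

theorem vol_ne_zero (T : HilbBasis h Ω k I c) (i : I) (hi : 0 < L.h0 (k + i)) : Ω.vol ≠ 0 := by
  intro h0
  have h1 := T.orthonormal i ⟨0, hi⟩ ⟨0, hi⟩
  simp [hilbInner, h0] at h1

theorem h0_pos (T : HilbBasis h Ω k I c) (i : I) {a : O.Idx} {z : Fin n → ℂ}
    (hz : L.ev (k + i) a z ≠ 0) : 0 < L.h0 (k + i) := by
  -- `finrank` is also `0` in infinite dimension; the finite basis in `T` excludes this case.
  have := Module.Finite.of_basis (T.t i)
  have : Nontrivial (L.H0 (k + i)) := by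
    by_contra hn
    rw [not_nontrivial_iff_subsingleton] at hn
    exact hz (Subsingleton.elim _ _)
  exact Module.finrank_pos

theorem integral_bergmanKernel [CompactSpace X] [BorelSpace X] [IsFiniteMeasure Ω.measure]
    (T : HilbBasis h Ω k I c) :
    ∫ x, T.bergmanKernel x ∂Ω.measure = L.balancingConstant k I c * Ω.vol := by
  have hint : ∀ (i : I) α, Integrable (normSq h (T.t i α)) Ω.measure := fun i α => by
    simpa [← ofReal_normSq] using (integrable_pairing (h := h) (Ω := Ω) (T.t i α) (T.t i α)).re
  simp only [bergmanKernel]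
  rw [integral_finsetSum _ fun i _ => (integrable_finsetSum _ fun α _ => hint i α).const_mul _,
    balancingConstant, ← Finset.sum_coe_sort I, Finset.sum_mul]
  refine Finset.sum_congr rfl fun i _ => ?_
  rw [integral_const_mul, integral_finsetSum _ fun α _ => hint i α]
  simp only [T.integral_normSq, Finset.sum_const, Finset.card_univ, Fintype.card_fin, nsmul_eq_mul]
  ring

end HilbBasis

end Hilb

/-! ### The equation defining the Fubini-Study metric -/

/-- The number `fsLambda` satisfies its defining equation, and it is the only positive solution. -/
theorem fsLambda_spec (k : ℕ) (I : Finset ℕ) (hI : ∀ i ∈ I, 0 < k + i) (c : ℕ → ℝ)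
    (N : ∀ i, Module.Dual ℂ (L.H0 (k + i)) → ℝ) (v : ∀ i, Module.Dual ℂ (L.H0 (k + i)))
    (hv : ∃ i ∈ I, N i (v i) ≠ 0) (hC : 0 < L.balancingConstant k I c) :
    (0 < L.fsLambda k I c N v ∧ ∑ i ∈ I, ((k + i : ℕ) : ℝ) *
        L.fsLambda k I c N v ^ (2 * (k + i)) * N i (v i) ^ 2 = L.balancingConstant k I c) ∧
      ∀ l : ℝ, 0 < l → ∑ i ∈ I, ((k + i : ℕ) : ℝ) * l ^ (2 * (k + i)) * N i (v i) ^ 2 =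
        L.balancingConstant k I c → l = L.fsLambda k I c N v := by
  set F : ℝ → ℝ := fun l => ∑ i ∈ I, ((k + i : ℕ) : ℝ) * l ^ (2 * (k + i)) * N i (v i) ^ 2 with hF
  set C := L.balancingConstant k I c
  obtain ⟨j, hj, hNj⟩ := hv
  have hterm : ∀ i ∈ I, ∀ l m : ℝ, 0 ≤ l → l ≤ m →
      ((k + i : ℕ) : ℝ) * l ^ (2 * (k + i)) * N i (v i) ^ 2 ≤
        ((k + i : ℕ) : ℝ) * m ^ (2 * (k + i)) * N i (v i) ^ 2 := fun i _ l m hl hlm => by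
    gcongr
  have hmono : StrictMonoOn F (Set.Ici 0) := fun l hl m hm hlm => by
    refine Finset.sum_lt_sum (fun i hi => hterm i hi l m hl hlm.le) ⟨j, hj, ?_⟩
    have hkj : (0 : ℝ) < (k + j : ℕ) := by exact_mod_cast hI j hj
    have hpow : l ^ (2 * (k + j)) < m ^ (2 * (k + j)) :=
      pow_lt_pow_left₀ hlm hl (by have := hI j hj; omega)
    have : 0 < N j (v j) ^ 2 := by positivity
    gcongr
  have hF0 : F 0 = 0 := Finset.sum_eq_zero fun i hi => by
    rw [zero_pow (by have := hI i hi; omega)]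
    ring
  have hcont : Continuous F := by fun_prop
  have hlim : Filter.Tendsto F Filter.atTop Filter.atTop := by
    have hkj : (0 : ℝ) < (k + j : ℕ) := by exact_mod_cast hI j hj
    have hj' : Filter.Tendsto (fun l : ℝ => ((k + j : ℕ) : ℝ) * l ^ (2 * (k + j)) *
        N j (v j) ^ 2) Filter.atTop Filter.atTop :=
      ((Filter.tendsto_pow_atTop (by have := hI j hj; omega)).const_mul_atTop
        hkj).atTop_mul_const (by positivity)
    refine Filter.tendsto_atTop_mono (fun l => ?_) hj'
    refine Finset.single_le_sum
      (f := fun i => ((k + i : ℕ) : ℝ) * l ^ (2 * (k + i)) * N i (v i) ^ 2) (fun i _ => ?_) hj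
    have : 0 ≤ l ^ (2 * (k + i)) := by
      rw [pow_mul]
      positivity
    positivity
  -- Intermediate value theorem between `F 0 = 0` and a large value; `C > 0` keeps the solution away
  -- from `0`.
  have hex : ∃ l : ℝ, 0 < l ∧ F l = C := by
    obtain ⟨m, hm, hmC⟩ :=
      ((hlim.eventually_ge_atTop C).and (Filter.eventually_ge_atTop 0)).exists
    obtain ⟨l, hl, hlC⟩ := intermediate_value_Icc hmC hcont.continuousOn
      (show C ∈ Set.Icc (F 0) (F m) from ⟨hF0.trans_le hC.le, hm⟩)
    refine ⟨l, lt_of_le_of_ne hl.1 fun h0 => ?_, hlC⟩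
    rw [← h0, hF0] at hlC
    exact hC.ne hlC
  have hspec : 0 < L.fsLambda k I c N v ∧ F (L.fsLambda k I c N v) = C :=
    Classical.epsilon_spec hex
  exact ⟨hspec, fun l hl hlC =>
    hmono.injOn (Set.mem_Ici.2 hl.le) (Set.mem_Ici.2 hspec.1.le) (hlC.trans hspec.2.symm)⟩

/-- The Fubini-Study metric is characterised by the defining equation of `fsLambda`. -/
theorem eq_fsMetric_iff (k : ℕ) (I : Finset ℕ) (hI : ∀ i ∈ I, 0 < k + i) (c : ℕ → ℝ)
    (N : ∀ i, Module.Dual ℂ (L.H0 (k + i)) → ℝ) (a : O.Idx) (z : Fin n → ℂ)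
    (hv : ∃ i ∈ I, N i (L.ev (k + i) a z) ≠ 0) (hC : 0 < L.balancingConstant k I c)
    {w : ℝ} (hw : 0 < w) :
    w = L.fsMetric k I c N a z ↔ ∑ i ∈ I, ((k + i : ℕ) : ℝ) * w ^ (k + i) *
      N i (L.ev (k + i) a z) ^ 2 = L.balancingConstant k I c := by
  obtain ⟨⟨-, heq⟩, huniq⟩ := fsLambda_spec k I hI c N (fun i => L.ev (k + i) a z) hv hC
  have hfs : L.fsMetric k I c N a z =
      (L.fsLambda k I c N fun i => L.ev (k + i) a z) ^ 2 := by
    rw [fsMetric, fsNorm, one_div, inv_inv]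
  rw [hfs]
  constructor
  · rintro rfl
    simpa only [pow_mul] using heq
  · intro hsum
    -- The equation in `w` is the one for `λ = √w`, because `λ^(2(k+i)) = w^(k+i)`.
    rw [← huniq (Real.sqrt w) (Real.sqrt_pos.2 hw) ?_, Real.sq_sqrt hw.le]
    simpa only [pow_mul, Real.sq_sqrt hw.le] using hsum

end OrbifoldLineBundle

/-! ### Balanced metrics and constant Bergman kernels -/

theorem mainTheorem12 {n : ℕ} {X : Type*} [TopologicalSpace X] [T2Space X] [CompactSpace X]
    [Nonempty X] [MeasurableSpace X] [BorelSpace X]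
    (O : OrbifoldAtlas n X) (L : OrbifoldLineBundle O)
    (h : L.HermitianMetric) (Ω : O.KahlerMetric) (hΩ : Ω ∈ L.kahlerClass)
    (k : ℕ) (I : Finset ℕ) (hI : ∀ i ∈ I, 0 < k + i)
    (c : ℕ → ℝ) (hc : ∀ i ∈ I, 0 < c i)
    (hφ : L.EmbeddingDefined k I)
    (T : OrbifoldLineBundle.HilbBasis h Ω k I c) :
    ((∀ a, ∀ z ∈ O.U a,
        h.w a z = L.fsMetric k I c (OrbifoldLineBundle.hilbNorm h Ω k c) a z) ↔
      ∃ b : ℝ, ∀ x : X, T.bergmanKernel x = b) ∧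
    (∀ b : ℝ, (∀ x : X, T.bergmanKernel x = b) → b = L.balancingConstant k I c) := by
  obtain ⟨x₀⟩ := ‹Nonempty X›
  obtain ⟨a₀, z₀, -⟩ := O.cover x₀
  obtain ⟨j, hj, hevj⟩ := hφ a₀ z₀ z₀.2
  have hposj : 0 < L.h0 (k + j) := T.h0_pos ⟨j, hj⟩ hevj
  have hvol : Ω.vol ≠ 0 := T.vol_ne_zero ⟨j, hj⟩ hposj
  -- An infinite total mass would be read as `vol = 0` by `toReal`, which a nonempty orthonormal
  -- basis forbids.
  have : IsFiniteMeasure Ω.measure :=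
    ⟨lt_top_iff_ne_top.2 fun htop => hvol (by rw [KahlerMetric.vol, htop, ENNReal.toReal_top])⟩
  have hC : 0 < L.balancingConstant k I c := by
    have hnonneg : ∀ i ∈ I, 0 ≤ c i * (k + i : ℕ) * L.h0 (k + i) := fun i hi => by
      have := hc i hi
      positivity
    refine Finset.sum_pos' hnonneg ⟨j, hj, ?_⟩
    have h1 := hc j hj
    have h2 : (0 : ℝ) < (k + j : ℕ) := by exact_mod_cast hI j hj
    have h3 : (0 : ℝ) < L.h0 (k + j) := by exact_mod_cast hposj
    positivity
  have hconst : ∀ b : ℝ, (∀ x : X, T.bergmanKernel x = b) → b = L.balancingConstant k I c := by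
    intro b hb
    have hint := T.integral_bergmanKernel
    simp only [hb, integral_const, smul_eq_mul] at hint
    rw [mul_comm] at hint
    exact mul_right_cancel₀ hvol hint
  have hiff : ∀ a (z : O.U a), h.w a z = L.fsMetric k I c (hilbNorm h Ω k c) a z ↔
      T.bergmanKernel (O.π a z) = L.balancingConstant k I c := by
    intro a z
    rw [T.bergmanKernel_π]
    refine eq_fsMetric_iff k I hI c _ a z ?_ hC (h.pos a z z.2)
    obtain ⟨i, hi, hev⟩ := hφ a z z.2
    refine ⟨i, hi, fun h0 => hev ?_⟩
    -- If the dual norm vanishes, the evaluation kills every basis section and is therefore zero,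
    -- against `hφ`.
    have hsq := hilbNorm_sq (T.t ⟨i, hi⟩) (T.orthonormal ⟨i, hi⟩) (L.ev (k + i) a z)
    rw [h0, zero_pow two_ne_zero, eq_comm,
      Finset.sum_eq_zero_iff_of_nonneg fun _ _ => sq_nonneg _] at hsq
    refine (T.t ⟨i, hi⟩).ext fun α => ?_
    simpa using hsq α (Finset.mem_univ α)
  refine ⟨⟨fun heq => ⟨L.balancingConstant k I c, fun x => ?_⟩, ?_⟩, hconst⟩
  · obtain ⟨a, z, rfl⟩ := O.cover x
    exact (hiff a z).1 (heq a z z.2)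
  · rintro ⟨b, hb⟩ a z hz
    exact (hiff a ⟨z, hz⟩).2 ((hb _).trans (hconst b hb))
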